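/- Let $(W,S)$, $S=\{s_1,s_2,s_3\}$, be a Coxeter system of one of the affine types of rank two, with $m_{ij}$ the order of $s_is_j$: type $\tilde A_2$: $(m_{12},m_{23},m_{13})=(3,3,3)$; type $\tilde C_2$: $(4,2,4)$; type $\tilde G_2$: $(6,2,3)$. Let $\ell$ be the length function. For $D\subseteq W$ put $D(u)=\sum_{w\in D}u^{\ell(w)}\in\mathbb Z[[u]]$. For index sets $I\subseteq J\subseteq\{1,2,3\}$ let $W_J=\langle s_j: j\in J\rangle$, $$W_{J/I}=\{w\in W_J:\ \ell(ws_i)>\ell(w)\ \ \forall i\in I\},\qquad W_{I\backslash J}=\{w\in W_J:\ \ell(s_iw)>\ell(w)\ \ \forall i\in I\}.$$ Let $H_i=\{w_i^k: k\in\mathbb Z_{\ge 0}\}$ for $i=1,2$, where - in type $\tilde A_2$: $w_1=s_3s_2s_1$ and $w_2=s_3s_1s_2$; - in type $\tilde C_2$: $w_1=s_3s_1s_2s_1$ and $w_2=s_3s_1s_2$; - in type $\tilde G_2$: $w_1=s_3s_1s_2$ and $w_2=s_3s_1s_2s_1s_2$. Define subsets $D_1,\dots,D_m$ of $W$ by -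 $(D_1,\dots,D_5)=(W_{\{1,2\}/\{2\}},\,H_1,\,W_{\{2,3\}/\{3\}},\,H_2,\,W_{\{1\}\backslash\{1,3\}})$ in types $\tilde A_2$ and $\tilde C_2$; - $(D_1,\dots,D_4)=(W_{\{2,1\}/\{1\}},\,H_2,\,H_1,\,W_{\{1,3\}})$ in type $\tilde G_2$. Then $D_1(u)\cdots D_m(u)=W(u)$, and $W=D_1\times\cdots\times D_m$, that is, every $w\in W$ can be written as $w=d_1\cdots d_m$ with $d_i\in D_i$ for all $i$ in exactly one way. -/

import Mathlib

/-- The Coxeter matrix of type `Ã₂` on the generators `s₁, s₂, s₃` (indexed by `0, 1, 2`):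
`(m₁₂, m₂₃, m₁₃) = (3, 3, 3)`. -/
def affineA2 : CoxeterMatrix (Fin 3) where
  M := !![1, 3, 3;
          3, 1, 3;
          3, 3, 1]
  isSymm := by decide
  diagonal := by decide
  off_diagonal := by simp +decide

/-- The Coxeter matrix of type `C̃₂`: `(m₁₂, m₂₃, m₁₃) = (4, 2, 4)`. -/
def affineC2 : CoxeterMatrix (Fin 3) where
  M := !![1, 4, 4;
          4, 1, 2;
          4, 2, 1]
  isSymm := by decide
  diagonal := by decide
  off_diagonal := by simp +decide

/-- The Coxeter matrix of type `G̃₂`: `(m₁₂, m₂₃, m₁₃) = (6, 2, 3)`. -/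
def affineG2 : CoxeterMatrix (Fin 3) where
  M := !![1, 6, 3;
          6, 1, 2;
          3, 2, 1]
  isSymm := by decide
  diagonal := by decide
  off_diagonal := by simp +decide

namespace CoxeterSystem

variable {B : Type*} {M : CoxeterMatrix B} {W : Type*} [Group W] (cs : CoxeterSystem M W)

/-- There are finitely many elements of each length when the generating set is finite, so the
coefficients of the Poincaré series below are genuine cardinalities. -/
theorem finite_setOf_length_eq [Finite B] (D : Set W) (n : ℕ) :
    {w | w ∈ D ∧ cs.length w = n}.Finite := by
  refine ((List.finite_length_eq B n).image cs.wordProd).subset ?_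
  rintro w ⟨-, hw⟩
  obtain ⟨ω, hω, rfl⟩ := cs.exists_isReduced w
  exact ⟨ω, hω.symm.trans hw, rfl⟩

/-- The Poincaré series `D(u) = ∑_{w ∈ D} u^{ℓ(w)} ∈ ℤ⟦u⟧` of a subset `D` of `W`: the coefficient
of `u ^ n` is the number of elements of `D` of length `n`. -/
noncomputable def poincareSeries (D : Set W) : PowerSeries ℤ :=
  PowerSeries.mk fun n => (({w | w ∈ D ∧ cs.length w = n}.ncard : ℕ) : ℤ)

/-- The subgroup `W_I` generated by `{s_i : i ∈ I}`. -/
def parabolic (I : Set B) : Subgroup W :=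
  Subgroup.closure (cs.simple '' I)

/-- `W_{J/I}`: the elements `w ∈ W_J` with `ℓ(ws) > ℓ(w)` for all `s ∈ I`. -/
def minLeftCosetReps (J I : Set B) : Set W :=
  {w | w ∈ cs.parabolic J ∧ ∀ i ∈ I, cs.length w < cs.length (w * cs.simple i)}

/-- `W_{I\J}`: the elements `w ∈ W_J` with `ℓ(sw) > ℓ(w)` for all `s ∈ I`. -/
def minRightCosetReps (I J : Set B) : Set W :=
  {w | w ∈ cs.parabolic J ∧ ∀ i ∈ I, cs.length w < cs.length (cs.simple i * w)}

end CoxeterSystem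

/-- `H = {w ^ k : k ∈ ℤ, k ≥ 0}`. -/
def nonnegPowers {W : Type*} [Group W] (w : W) : Set W :=
  {x | ∃ k : ℕ, w ^ k = x}

/-- `W = D₁ × ⋯ × D_m`: every element of `W` is `d₁ ⋯ d_m` for a unique tuple with `d_i ∈ D_i`. -/
def IsFactorization {W : Type*} [Group W] {m : ℕ} (D : Fin m → Set W) : Prop :=
  ∀ w : W, ∃! d : Fin m → W, (∀ i, d i ∈ D i) ∧ (List.ofFn d).prod = w

/-- The five factors `(W_{{1,2}/{2}}, H₁, W_{{2,3}/{3}}, H₂, W_{{1}\{1,3}})` for type `Ã₂`, where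
`w₁ = s₃s₂s₁`, `w₂ = s₃s₁s₂` and `H_i` is the set of powers `w_i ^ k`, `k ≥ 0`. -/
def factorsA2 {W : Type*} [Group W] (cs : CoxeterSystem affineA2 W) : Fin 5 → Set W :=
  ![cs.minLeftCosetReps {0, 1} {1},
    nonnegPowers (cs.simple 2 * cs.simple 1 * cs.simple 0),
    cs.minLeftCosetReps {1, 2} {2},
    nonnegPowers (cs.simple 2 * cs.simple 0 * cs.simple 1),
    cs.minRightCosetReps {0} {0, 2}]

/-- The same five factors for type `C̃₂`, where `w₁ = s₃s₁s₂s₁`, `w₂ = s₃s₁s₂`. -/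
def factorsC2 {W : Type*} [Group W] (cs : CoxeterSystem affineC2 W) : Fin 5 → Set W :=
  ![cs.minLeftCosetReps {0, 1} {1},
    nonnegPowers (cs.simple 2 * cs.simple 0 * cs.simple 1 * cs.simple 0),
    cs.minLeftCosetReps {1, 2} {2},
    nonnegPowers (cs.simple 2 * cs.simple 0 * cs.simple 1),
    cs.minRightCosetReps {0} {0, 2}]

/-- The four factors `(W_{{2,1}/{1}}, H₂, H₁, W_{{1,3}})` for type `G̃₂`, where
`w₁ = s₃s₁s₂`, `w₂ = s₃s₁s₂s₁s₂`. -/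
def factorsG2 {W : Type*} [Group W] (cs : CoxeterSystem affineG2 W) : Fin 4 → Set W :=
  ![cs.minLeftCosetReps {1, 0} {0},
    nonnegPowers (cs.simple 2 * cs.simple 0 * cs.simple 1 * cs.simple 0 * cs.simple 1),
    nonnegPowers (cs.simple 2 * cs.simple 0 * cs.simple 1),
    (cs.parabolic {0, 2} : Set W)]

/-! The group acts on the plane by affine reflections, and each alcove is represented by one lattice
point, `center w`. Two facts reduce the theorem to integer arithmetic. The map `center` is
injective, because only the identity fixes the base point (`eq_one_of_center_eq`). The length of `w`
is the number of reflecting lines between the base alcove and that of `w` (`length_eq`, from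
`length_eq_of_wall`). Hence left multiplication by a generator reflects the alcove, and lengthens
`w` exactly when the corresponding `wall` is positive there.

The factors are peeled off from the left along a decreasing chain of regions. In type Ã₂ three
copies of a double chamber tile the plane; `w₁` maps the double chamber into itself and misses a
tripod of three half-strips; these are translates of one half-strip by the third factor; `w₂` maps
that half-strip into itself and misses three alcoves, the last factor. Type C̃₂ is the same with
four double chambers, a bipod and four final alcoves. In type G̃₂ six double chambers tile the
plane, the longer element `w₂` misses a half-strip, and `w₁` misses a triangle of six alcoves, which
is the finite group generated by `s₁` and `s₃`.

Each stage is an `IsReducedProduct`, that is, a unique factorization with additive lengths. Finite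
factors are handled by `IsReducedProduct.of_translates`, sets of powers by
`IsReducedProduct.nonnegPowers`. Reduced products multiply Poincaré series and can be nested. -/

/-! ### Reduced products of subsets of a Coxeter group -/

/-- A family of sets factorizes `C` if the product map from the tuples is a bijection onto `C`. -/
def FactorizesSet {W : Type*} [Group W] {m : ℕ} (D : Fin m → Set W) (C : Set W) : Prop :=
  (∀ d : Fin m → W, (∀ i, d i ∈ D i) → (List.ofFn d).prod ∈ C) ∧
    ∀ w ∈ C, ∃! d : Fin m → W, (∀ i, d i ∈ D i) ∧ (List.ofFn d).prod = w

namespace CoxeterSystem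

variable {B : Type*} {M : CoxeterMatrix B} {W : Type*} [Group W] (cs : CoxeterSystem M W)

/-- `C = A × B'` with additive lengths. -/
structure IsReducedProduct (A A' C : Set W) : Prop where
  mul_mem : ∀ a ∈ A, ∀ b ∈ A', a * b ∈ C
  length_mul : ∀ a ∈ A, ∀ b ∈ A', cs.length (a * b) = cs.length a + cs.length b
  left_unique : ∀ a ∈ A, ∀ b ∈ A', ∀ a' ∈ A, ∀ b' ∈ A', a * b = a' * b' → a = a'
  exists_eq : ∀ c ∈ C, ∃ a ∈ A, ∃ b ∈ A', a * b = c

variable {cs}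

/-- Multiplication matches the pairs of lengths `k`, `l` with `k + l = n` bijectively with the
elements of `C` of length `n`, which is the `n`-th coefficient of the Cauchy product. -/
theorem IsReducedProduct.poincareSeries_eq [Finite B] {A A' C : Set W}
    (h : cs.IsReducedProduct A A' C) :
    cs.poincareSeries A * cs.poincareSeries A' = cs.poincareSeries C := by
  classical
  ext n
  rw [PowerSeries.coeff_mul]
  simp only [poincareSeries, PowerSeries.coeff_mk]
  let F : Set W → ℕ → Finset W := fun D k => (cs.finite_setOf_length_eq D k).toFinset
  have hF : ∀ (D : Set W) k, ({w | w ∈ D ∧ cs.length w = k}.ncard : ℕ) = (F D k).card :=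
    fun D k => Set.ncard_eq_toFinset_card _ (cs.finite_setOf_length_eq D k)
  have mF : ∀ (D : Set W) k w, w ∈ F D k ↔ w ∈ D ∧ cs.length w = k := by
    intro D k w; simp [F]
  simp only [hF]
  norm_cast
  simp_rw [← Finset.card_product]
  rw [← Finset.card_sigma]
  refine Finset.card_bij (fun x _ => x.2.1 * x.2.2) ?_ ?_ ?_
  · rintro ⟨⟨k, l⟩, a, b⟩ hx
    simp only [Finset.mem_sigma, Finset.mem_product, mF] at hx ⊢
    obtain ⟨hkl, ⟨ha, rfl⟩, hb, rfl⟩ := hx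
    exact ⟨h.mul_mem a ha b hb, by rw [h.length_mul a ha b hb, Finset.HasAntidiagonal.mem_antidiagonal.1 hkl]⟩
  · rintro ⟨⟨k, l⟩, a, b⟩ hx ⟨⟨k', l'⟩, a', b'⟩ hx' he
    simp only [Finset.mem_sigma, Finset.mem_product, mF] at hx hx' he
    obtain ⟨hkl, ⟨ha, rfl⟩, hb, rfl⟩ := hx
    obtain ⟨hkl', ⟨ha', rfl⟩, hb', rfl⟩ := hx'
    obtain rfl := h.left_unique a ha b hb a' ha' b' hb' he
    obtain rfl := mul_left_cancel he
    rfl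
  · intro c hc
    rw [mF] at hc
    obtain ⟨a, ha, b, hb, rfl⟩ := h.exists_eq c hc.1
    refine ⟨⟨(cs.length a, cs.length b), a, b⟩, ?_, rfl⟩
    simp only [Finset.mem_sigma, Finset.mem_product, mF]
    exact ⟨Finset.HasAntidiagonal.mem_antidiagonal.2 (by rw [← h.length_mul a ha b hb, hc.2]), ⟨ha, trivial⟩, hb, trivial⟩

theorem IsReducedProduct.factorizesSet {A A' C : Set W} (h : cs.IsReducedProduct A A' C)
    {m : ℕ} {D : Fin m → Set W} (hD : FactorizesSet D A') :
    FactorizesSet (Matrix.vecCons A D) C := by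
  constructor
  · intro d hd
    rw [List.ofFn_succ, List.prod_cons]
    exact h.mul_mem _ (hd 0) _ (hD.1 _ fun i => hd i.succ)
  · intro w hw
    obtain ⟨a, ha, b, hb, rfl⟩ := h.exists_eq w hw
    obtain ⟨d, ⟨hd, rfl⟩, hu⟩ := hD.2 b hb
    refine ⟨Fin.cons a d, ⟨fun i => ?_, by simp [List.ofFn_succ]⟩, ?_⟩
    · refine Fin.cases ?_ (fun j => ?_) i
      · exact ha
      · exact hd j
    · rintro e ⟨he, hp⟩
      rw [List.ofFn_succ, List.prod_cons] at hp
      have he' : (List.ofFn fun i : Fin m => e i.succ).prod ∈ A' := hD.1 _ fun i => he i.succ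
      obtain rfl : e 0 = a := h.left_unique _ (he 0) _ he' _ ha _ hb hp
      have := hu (fun i => e i.succ) ⟨fun i => he i.succ, mul_left_cancel hp⟩
      rw [← this]
      exact (Fin.cons_self_tail e).symm

theorem factorizesSet_singleton (A : Set W) : FactorizesSet ![A] A := by
  constructor
  · intro d hd
    simpa using hd 0
  · intro w hw
    refine ⟨![w], ⟨by simpa using hw, by simp⟩, ?_⟩
    rintro e ⟨-, he⟩
    ext i
    fin_cases i
    simpa using he

/-- If `C` is stable under left multiplication by `w`, which adds `ℓ(w)` to the length there, and
`A` is the complement of `w C` in `C`, then `C` is the disjoint union of the sets `w ^ k A`. -/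
theorem IsReducedProduct.nonnegPowers {w : W} (hw : w ≠ 1) {A C : Set W} (hone : 1 ∈ C)
    (hmul : ∀ g ∈ C, w * g ∈ C ∧ cs.length (w * g) = cs.length w + cs.length g)
    (hsub : ∀ g ∈ A, g ∈ C ∧ w⁻¹ * g ∉ C)
    (hcompl : ∀ g ∈ C, g ∈ A ∨ w⁻¹ * g ∈ C) :
    cs.IsReducedProduct (nonnegPowers w) A C := by
  have hpow : ∀ (k : ℕ), ∀ g ∈ C, w ^ k * g ∈ C ∧
      cs.length (w ^ k * g) = k * cs.length w + cs.length g := by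
    intro k
    induction k with
    | zero => intro g hg; simpa using hg
    | succ k ih =>
      intro g hg
      obtain ⟨h1, h2⟩ := ih g hg
      obtain ⟨h3, h4⟩ := hmul _ h1
      rw [pow_succ', mul_assoc]
      exact ⟨h3, by rw [h4, h2]; ring⟩
  -- The case `g = 1` of `hpow`; this is where `1 ∈ C` enters.
  have hlen : ∀ k : ℕ, cs.length (w ^ k) = k * cs.length w := by
    intro k
    simpa using (hpow k 1 hone).2
  -- Cancelling `w ^ k` leaves `b = w ^ j * b'`; for `j > 0` this would put `b` in `w C`, which `A`
  -- avoids.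
  have key : ∀ (k j : ℕ) (b b' : W), b ∈ A → b' ∈ A → w ^ k * b = w ^ (k + j) * b' → j = 0 := by
    intro k j b b' hb hb' he
    rw [pow_add, mul_assoc] at he
    have he := mul_left_cancel he
    cases j with
    | zero => rfl
    | succ j =>
      refine absurd ?_ (hsub b hb).2
      rw [he, pow_succ', mul_assoc, inv_mul_cancel_left]
      exact (hpow j b' (hsub b' hb').1).1
  refine ⟨?_, ?_, ?_, ?_⟩
  · rintro _ ⟨k, rfl⟩ b hb
    exact (hpow k b (hsub b hb).1).1
  · rintro _ ⟨k, rfl⟩ b hb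
    rw [hlen, (hpow k b (hsub b hb).1).2]
  · rintro _ ⟨k, rfl⟩ b hb _ ⟨l, rfl⟩ b' hb' he
    rcases le_total k l with h | h
    · obtain ⟨j, rfl⟩ := Nat.exists_eq_add_of_le h
      rw [key k j b b' hb hb' he, add_zero]
    · obtain ⟨j, rfl⟩ := Nat.exists_eq_add_of_le h
      rw [key l j b' b hb' hb he.symm, add_zero]
  -- Existence is by descent on length: as long as `c` lies in `w C`, removing `w` shortens it by
  -- `ℓ(w) > 0`.
  · have hpos : 0 < cs.length w := Nat.pos_of_ne_zero fun h => hw (cs.length_eq_zero_iff.1 h)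
    suffices ∀ n, ∀ c ∈ C, cs.length c = n →
        ∃ k : ℕ, ∃ b ∈ A, w ^ k * b = c by
      intro c hc
      obtain ⟨k, b, hb, h⟩ := this _ c hc rfl
      exact ⟨_, ⟨k, rfl⟩, b, hb, h⟩
    intro n
    induction n using Nat.strong_induction_on with
    | _ n ih =>
      rintro c hc rfl
      rcases hcompl c hc with h | h
      · exact ⟨0, c, h, by simp⟩
      · have := (hmul _ h).2
        rw [mul_inv_cancel_left] at this
        obtain ⟨k, b, hb, he⟩ := ih _ (by omega) _ h rfl
        exact ⟨k + 1, b, hb, by rw [pow_succ', mul_assoc, he, mul_inv_cancel_left]⟩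

/-- Suited to geometric regions: the translates of `A'` by `A` must be pairwise disjoint and cover
`C`, and membership in a translate is tested by applying `a⁻¹`. -/
theorem IsReducedProduct.of_translates {A A' C : Set W}
    (hmul : ∀ a ∈ A, ∀ g ∈ A', a * g ∈ C ∧ cs.length (a * g) = cs.length a + cs.length g)
    (hdisj : ∀ a ∈ A, ∀ a' ∈ A, ∀ g ∈ A', a'⁻¹ * (a * g) ∈ A' → a = a')
    (hcover : ∀ g ∈ C, ∃ a ∈ A, a⁻¹ * g ∈ A') : cs.IsReducedProduct A A' C := by
  refine ⟨fun a ha b hb => (hmul a ha b hb).1, fun a ha b hb => (hmul a ha b hb).2, ?_, ?_⟩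
  · intro a ha b hb a' ha' b' hb' he
    exact hdisj a ha a' ha' b hb (by rwa [he, inv_mul_cancel_left])
  · intro c hc
    obtain ⟨a, ha, h⟩ := hcover c hc
    exact ⟨a, ha, _, h, mul_inv_cancel_left a c⟩

/-! ### Orbit maps and a length formula -/

variable (cs)

theorem parabolic_induction {I : Set B} {p : W → Prop} (one : p 1)
    (simple_mul : ∀ i ∈ I, ∀ w, p w → p (cs.simple i * w)) {w : W} (hw : w ∈ cs.parabolic I) :
    p w := by
  induction hw using Subgroup.closure_induction_left with
  | one => exact one
  | mul_left x hx y _ ih =>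
    obtain ⟨i, hi, rfl⟩ := hx
    exact simple_mul i hi y ih
  | inv_mul_cancel x hx y _ ih =>
    obtain ⟨i, hi, rfl⟩ := hx
    rw [inv_simple]
    exact simple_mul i hi y ih

theorem simple_mem_parabolic {I : Set B} {i : B} (hi : i ∈ I) : cs.simple i ∈ cs.parabolic I :=
  Subgroup.subset_closure ⟨i, hi, rfl⟩

/-- The orbit map `w ↦ w • p` of the action of `W` by transformations `f i` satisfying the Coxeter
relations. -/
def orbitMap {X : Type*} {f : B → X → X} (hf : M.IsLiftable (G := Function.End X) f) (p : X) (w : W) : X :=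
  cs.lift (G := Function.End X) ⟨f, hf⟩ w p

section orbitMap

variable {X : Type*} {f : B → X → X} (hf : M.IsLiftable (G := Function.End X) f) (p : X)

@[simp] theorem orbitMap_one : cs.orbitMap hf p 1 = p := by
  simp only [orbitMap, map_one]
  rfl

theorem orbitMap_mul (v w : W) :
    cs.orbitMap hf p (v * w) =
      cs.lift (G := Function.End X) ⟨f, hf⟩ v (cs.orbitMap hf p w) := by
  simp only [orbitMap, map_mul]
  rfl

@[simp] theorem orbitMap_simple_mul (i : B) (w : W) :
    cs.orbitMap hf p (cs.simple i * w) = f i (cs.orbitMap hf p w) := by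
  rw [orbitMap_mul]
  exact congrFun (cs.lift_apply_simple (G := Function.End X) hf i) _

@[simp] theorem orbitMap_simple (i : B) : cs.orbitMap hf p (cs.simple i) = f i p := by
  simpa using cs.orbitMap_simple_mul hf p i 1

theorem orbitMap_injective (hstab : ∀ w, cs.orbitMap hf p w = p → w = 1) :
    Function.Injective (cs.orbitMap hf p) := by
  intro v w h
  have : cs.orbitMap hf p (w⁻¹ * v) = p := by
    rw [orbitMap_mul, h, ← orbitMap_mul, inv_mul_cancel, orbitMap_one]
  exact (inv_mul_eq_one.1 (hstab _ this)).symm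

/-- Along a reduced word `L` grows by at most one per letter, so `L` is at most the length.
Conversely, descending steps lead from any orbit point to `p`, where triviality of the stabilizer
identifies the element as `1`. -/
theorem length_eq_of_descent (hstab : ∀ w, cs.orbitMap hf p w = p → w = 1) {orb : X → Prop}
    {L : X → ℕ} (orb_base : orb p) (L_base : L p = 0) (orb_apply : ∀ i q, orb q → orb (f i q))
    (L_apply : ∀ i q, orb q → L (f i q) ≤ L q + 1)
    (L_descent : ∀ q, orb q → q ≠ p → ∃ i, L (f i q) < L q) (w : W) :
    orb (cs.orbitMap hf p w) ∧ cs.length w = L (cs.orbitMap hf p w) := by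
  have horb : ∀ w, orb (cs.orbitMap hf p w) := by
    intro w
    induction w using cs.simple_induction_left with
    | one => simpa
    | mul_simple_left w i ih => rw [orbitMap_simple_mul]; exact orb_apply i _ ih
  have hle : ∀ w, L (cs.orbitMap hf p w) ≤ cs.length w := by
    intro w
    obtain ⟨ω, hω, rfl⟩ := cs.exists_isReduced w
    rw [hω.eq]
    clear hω
    induction ω with
    | nil => simp [L_base]
    | cons i ω ih =>
      rw [wordProd_cons, orbitMap_simple_mul, List.length_cons]
      exact (L_apply i _ (horb _)).trans (by omega)
  refine ⟨horb w, le_antisymm ?_ (hle w)⟩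
  suffices ∀ n, ∀ w, L (cs.orbitMap hf p w) = n → cs.length w ≤ n from this _ w rfl
  intro n
  induction n using Nat.strong_induction_on with
  | _ n ih =>
    rintro w rfl
    by_cases h : cs.orbitMap hf p w = p
    · simp [hstab w h]
    · obtain ⟨i, hi⟩ := L_descent _ (horb w) h
      rw [← cs.orbitMap_simple_mul hf p] at hi
      have := ih _ hi _ rfl
      rcases cs.length_simple_mul w i with h' | h' <;> omega

/-- A length formula for a group acting simply transitively on the alcoves of an arrangement:
`wall i q` is the sign of the `i`-th simple wall at `q`, and `depth q` counts the hyperplanes between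
`q` and the base point. -/
theorem length_eq_of_wall (hstab : ∀ w, cs.orbitMap hf p w = p → w = 1) {orb : X → Prop}
    {depth : X → ℕ} {wall : B → X → ℤ} (orb_base : orb p) (depth_base : depth p = 0)
    (orb_apply : ∀ i q, orb q → orb (f i q))
    (depth_apply : ∀ i q, orb q → 0 < wall i q ∧ depth (f i q) = depth q + 1 ∨
      wall i q < 0 ∧ depth (f i q) + 1 = depth q)
    (exists_wall_neg : ∀ q, orb q → q ≠ p → ∃ i, wall i q < 0) (w : W) :
    orb (cs.orbitMap hf p w) ∧ cs.length w = depth (cs.orbitMap hf p w) := by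
  refine cs.length_eq_of_descent hf p hstab orb_base depth_base orb_apply ?_ ?_ w
  · intro i q h
    have := depth_apply i q h
    omega
  · intro q h hne
    obtain ⟨i, hi⟩ := exists_wall_neg q h hne
    have := depth_apply i q h
    exact ⟨i, by omega⟩

end orbitMap

end CoxeterSystem

/-! ### Normal form: translations times a finite group -/

/-- Moving `s` past the products of powers of two commuting elements whose group it normalizes. -/
theorem mul_zpow_mul_zpow_of_semiconj {G : Type*} [Group G] {s t u : G} (htu : Commute t u)
    {i j k l : ℤ} (h1 : s * t = t ^ i * u ^ j * s) (h2 : s * u = t ^ k * u ^ l * s) (a b : ℤ) :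
    s * (t ^ a * u ^ b) = t ^ (i * a + k * b) * u ^ (j * a + l * b) * s := by
  have h1' : s * t ^ a = (t ^ i * u ^ j) ^ a * s := SemiconjBy.zpow_right h1 a
  have h2' : s * u ^ b = (t ^ k * u ^ l) ^ b * s := SemiconjBy.zpow_right h2 b
  rw [← mul_assoc, h1', mul_assoc, h2', ← mul_assoc,
    (htu.zpow_zpow i j).mul_zpow, (htu.zpow_zpow k l).mul_zpow, ← zpow_mul, ← zpow_mul, ← zpow_mul,
    ← zpow_mul, zpow_add, zpow_add]
  congr 1
  rw [mul_assoc, mul_assoc]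
  congr 1
  rw [← mul_assoc, ← mul_assoc, (htu.zpow_zpow (k * b) (j * a)).eq]

namespace CoxeterSystem

variable {B : Type*} {M : CoxeterMatrix B} {W : Type*} [Group W] (cs : CoxeterSystem M W)

/-- Only the effect of `t` on orbit points is needed; negative powers follow by applying `ht` to
`t⁻¹ * g`. -/
theorem orbitMap_zpow_mul {X : Type*} [AddCommGroup X] {f : B → X → X}
    (hf : M.IsLiftable (G := Function.End X) f) (p : X) {t : W} {v : X}
    (ht : ∀ g, cs.orbitMap hf p (t * g) = cs.orbitMap hf p g + v) (a : ℤ) (g : W) :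
    cs.orbitMap hf p (t ^ a * g) = cs.orbitMap hf p g + a • v := by
  induction a using Int.induction_on generalizing g with
  | zero => simp
  | succ n ih => rw [zpow_add_one, mul_assoc, ih, ht, add_zsmul, one_zsmul]; abel
  | pred n ih =>
    rw [zpow_sub_one, mul_assoc, ih]
    have := ht (t⁻¹ * g)
    rw [mul_inv_cancel_left] at this
    rw [this, sub_zsmul, one_zsmul]
    abel

/-- Every element of an affine Weyl group with two generating translations `t`, `u` is a translation
times an element of the finite Weyl group `⟨s i, s j⟩`. -/
theorem exists_eq_zpow_mul_zpow_mul {M : CoxeterMatrix (Fin 3)} (cs : CoxeterSystem M W)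
    {t u r : W} (comm : Commute t u) {c d : Fin 2 → Fin 2 → ℤ}
    (h0t : cs.simple 0 * t = t ^ c 0 0 * u ^ c 0 1 * cs.simple 0)
    (h0u : cs.simple 0 * u = t ^ c 1 0 * u ^ c 1 1 * cs.simple 0)
    (h1t : cs.simple 1 * t = t ^ d 0 0 * u ^ d 0 1 * cs.simple 1)
    (h1u : cs.simple 1 * u = t ^ d 1 0 * u ^ d 1 1 * cs.simple 1)
    (hr : r ∈ cs.parabolic {0, 1}) (h2 : cs.simple 2 = t * r) (w : W) :
    ∃ a b : ℤ, ∃ w₀ ∈ cs.parabolic {0, 1}, w = t ^ a * (u ^ b * w₀) := by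
  have h0 : ∀ w, (∃ a b : ℤ, ∃ w₀ ∈ cs.parabolic {0, 1}, w = t ^ a * (u ^ b * w₀)) →
      ∃ a b : ℤ, ∃ w₀ ∈ cs.parabolic {0, 1}, cs.simple 0 * w = t ^ a * (u ^ b * w₀) := by
    rintro _ ⟨a, b, w₀, hw, rfl⟩
    refine ⟨c 0 0 * a + c 1 0 * b, c 0 1 * a + c 1 1 * b, _, mul_mem (cs.simple_mem_parabolic (i := 0) (by simp)) hw, ?_⟩
    have := congrArg (· * w₀) (mul_zpow_mul_zpow_of_semiconj comm h0t h0u a b)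
    simpa only [mul_assoc] using this
  have h1 : ∀ w, (∃ a b : ℤ, ∃ w₀ ∈ cs.parabolic {0, 1}, w = t ^ a * (u ^ b * w₀)) →
      ∃ a b : ℤ, ∃ w₀ ∈ cs.parabolic {0, 1}, cs.simple 1 * w = t ^ a * (u ^ b * w₀) := by
    rintro _ ⟨a, b, w₀, hw, rfl⟩
    refine ⟨d 0 0 * a + d 1 0 * b, d 0 1 * a + d 1 1 * b, _, mul_mem (cs.simple_mem_parabolic (i := 1) (by simp)) hw, ?_⟩
    have := congrArg (· * w₀) (mul_zpow_mul_zpow_of_semiconj comm h1t h1u a b)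
    simpa only [mul_assoc] using this
  -- Stability under `s 0` and `s 1` extends to the group they generate; this is needed for `r`,
  -- since `s 2 = t * r`.
  have hpar : ∀ v ∈ cs.parabolic {0, 1}, ∀ w, (∃ a b : ℤ, ∃ w₀ ∈ cs.parabolic {0, 1}, w = t ^ a * (u ^ b * w₀)) →
      ∃ a b : ℤ, ∃ w₀ ∈ cs.parabolic {0, 1}, v * w = t ^ a * (u ^ b * w₀) := by
    intro v hv w hw
    refine cs.parabolic_induction (I := {0, 1})
      (p := fun v => ∃ a b : ℤ, ∃ w₀ ∈ cs.parabolic {0, 1}, v * w = t ^ a * (u ^ b * w₀)) (by simpa using hw) ?_ hv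
    rintro i (rfl | rfl) v hv
    · rw [mul_assoc]; exact h0 _ hv
    · rw [mul_assoc]; exact h1 _ hv
  induction w using cs.simple_induction_left with
  | one => exact ⟨0, 0, 1, one_mem _, by simp⟩
  | mul_simple_left w i ih =>
    fin_cases i
    · exact h0 w ih
    · exact h1 w ih
    · obtain ⟨a, b, w₀, hw, h⟩ := hpar r hr w ih
      refine ⟨a + 1, b, w₀, hw, ?_⟩
      change cs.simple 2 * w = _
      rw [h2, mul_assoc, h, zpow_add_one, ((Commute.refl t).zpow_left a).eq, mul_assoc]

end CoxeterSystem

/-! ### Braid relations and rank-two parabolic subgroups -/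

namespace CoxeterSystem

variable {B : Type*} {M : CoxeterMatrix B} {W : Type*} [Group W] (cs : CoxeterSystem M W)

section dihedral

variable {cs} {i j : B}

theorem braid_two (h : M i j = 2) : cs.simple i * cs.simple j = cs.simple j * cs.simple i := by
  have hm := cs.simple_mul_simple_pow i j
  rw [h, pow_two] at hm
  have hi := cs.simple_mul_simple_self i
  have hj := cs.simple_mul_simple_self j
  grind

theorem braid_three (h : M i j = 3) :
    cs.simple i * cs.simple j * cs.simple i = cs.simple j * cs.simple i * cs.simple j := by
  have hm := cs.simple_mul_simple_pow i j
  rw [h, pow_succ, pow_two] at hm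
  have hi := cs.simple_mul_simple_self i
  have hj := cs.simple_mul_simple_self j
  grind

theorem braid_four (h : M i j = 4) :
    cs.simple i * cs.simple j * cs.simple i * cs.simple j =
      cs.simple j * cs.simple i * cs.simple j * cs.simple i := by
  have hm := cs.simple_mul_simple_pow i j
  rw [h, pow_succ, pow_succ, pow_two] at hm
  have hi := cs.simple_mul_simple_self i
  have hj := cs.simple_mul_simple_self j
  grind

theorem braid_six (h : M i j = 6) :
    cs.simple i * cs.simple j * cs.simple i * cs.simple j * cs.simple i * cs.simple j =
      cs.simple j * cs.simple i * cs.simple j * cs.simple i * cs.simple j * cs.simple i := by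
  have hm := cs.simple_mul_simple_pow i j
  rw [h, pow_succ, pow_succ, pow_succ, pow_succ, pow_two] at hm
  have hi := cs.simple_mul_simple_self i
  have hj := cs.simple_mul_simple_self j
  grind

/-- The listed words contain `1` and are closed under left multiplication by both generators. Their
distinctness is not claimed here; where it matters, `center` separates them. The same holds for
orders 3, 4 and 6. -/
theorem mem_of_mem_parabolic_two (h : M i j = 2) {w : W} (hw : w ∈ cs.parabolic {i, j}) :
    w ∈ ({1, cs.simple i, cs.simple j, cs.simple i * cs.simple j} : Set W) := by
  have hb := braid_two (cs := cs) h
  refine cs.parabolic_induction (by simp) ?_ hw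
  rintro k (rfl | rfl) w (rfl | rfl | rfl | rfl) <;> simp [hb]
  simp [← hb]

theorem mem_of_mem_parabolic_three (h : M i j = 3) {w : W} (hw : w ∈ cs.parabolic {i, j}) :
    w ∈ ({1, cs.simple i, cs.simple j, cs.simple i * cs.simple j, cs.simple j * cs.simple i,
      cs.simple i * (cs.simple j * cs.simple i)} : Set W) := by
  have hb := braid_three (cs := cs) h
  simp only [mul_assoc] at hb
  refine cs.parabolic_induction (by simp) ?_ hw
  rintro k (rfl | rfl) w (rfl | rfl | rfl | rfl | rfl | rfl) <;> simp [hb]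
  simp [← hb]

theorem mem_of_mem_parabolic_four (h : M i j = 4) {w : W} (hw : w ∈ cs.parabolic {i, j}) :
    w ∈ ({1, cs.simple i, cs.simple j, cs.simple i * cs.simple j, cs.simple j * cs.simple i,
      cs.simple i * (cs.simple j * cs.simple i), cs.simple j * (cs.simple i * cs.simple j),
      cs.simple i * (cs.simple j * (cs.simple i * cs.simple j))} : Set W) := by
  have hb := braid_four (cs := cs) h
  simp only [mul_assoc] at hb
  refine cs.parabolic_induction (by simp) ?_ hw
  rintro k (rfl | rfl) w (rfl | rfl | rfl | rfl | rfl | rfl | rfl | rfl) <;> simp [hb]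
  simp [← hb]

set_option maxHeartbeats 1000000 in
theorem mem_of_mem_parabolic_six (h : M i j = 6) {w : W} (hw : w ∈ cs.parabolic {i, j}) :
    w ∈ ({1, cs.simple i, cs.simple j, cs.simple i * cs.simple j, cs.simple j * cs.simple i,
      cs.simple i * (cs.simple j * cs.simple i), cs.simple j * (cs.simple i * cs.simple j),
      cs.simple i * (cs.simple j * (cs.simple i * cs.simple j)),
      cs.simple j * (cs.simple i * (cs.simple j * cs.simple i)),
      cs.simple i * (cs.simple j * (cs.simple i * (cs.simple j * cs.simple i))),
      cs.simple j * (cs.simple i * (cs.simple j * (cs.simple i * cs.simple j))),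
      cs.simple i * (cs.simple j * (cs.simple i * (cs.simple j * (cs.simple i * cs.simple j))))} :
        Set W) := by
  have hb := braid_six (cs := cs) h
  simp only [mul_assoc] at hb
  refine cs.parabolic_induction (by simp) ?_ hw
  rintro k (rfl | rfl) w
    (rfl | rfl | rfl | rfl | rfl | rfl | rfl | rfl | rfl | rfl | rfl | rfl) <;> simp [hb]
  simp [← hb]

end dihedral

end CoxeterSystem

/-! ### Type Ã₂ -/

namespace AffineA2

/-- The generators of type `Ã₂` as affine reflections, in the coordinates given by the simple roots,
scaled such that the fundamental alcove is bounded by `x = 0`, `y = 0` and `x + y = 3`. -/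
def refl : Fin 3 → ℤ × ℤ → ℤ × ℤ :=
  ![fun q => (-q.1, q.1 + q.2), fun q => (q.1 + q.2, -q.2), fun q => (3 - q.2, 3 - q.1)]

theorem isLiftable_refl : affineA2.IsLiftable (G := Function.End (ℤ × ℤ)) refl := by
  intro i j
  funext ⟨x, y⟩
  -- A power in `Function.End` is an iterate, so each Coxeter relation becomes a computation with
  -- explicit affine maps.
  change ((refl i ∘ refl j)^[affineA2.M i j]) (x, y) = (x, y)
  fin_cases i <;> fin_cases j <;> simp [affineA2, refl] <;> ring_nf <;> trivial

/-- The centres of the alcoves. -/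
def IsCenter (q : ℤ × ℤ) : Prop :=
  q.1 % 3 = 1 ∧ q.2 % 3 = 1 ∨ q.1 % 3 = 2 ∧ q.2 % 3 = 2

/-- The number of walls between the fundamental alcove and the alcove of `q`. -/
def depth (q : ℤ × ℤ) : ℕ :=
  (q.1 / 3).natAbs + (q.2 / 3).natAbs + ((q.1 + q.2) / 3).natAbs

/-- The affine functions that are positive on the fundamental alcove and vanish on its walls. -/
def wall : Fin 3 → ℤ × ℤ → ℤ :=
  ![fun q => q.1, fun q => q.2, fun q => 3 - q.1 - q.2]

theorem IsCenter.refl {q : ℤ × ℤ} (h : IsCenter q) (i : Fin 3) : IsCenter (refl i q) := by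
  fin_cases i <;> simp [IsCenter, AffineA2.refl] at h ⊢ <;> omega

/-- The reflection permutes the terms of `depth` belonging to the other families of parallel lines;
only the term of its own family changes, by one. -/
theorem depth_refl {q : ℤ × ℤ} (h : IsCenter q) (i : Fin 3) :
    0 < wall i q ∧ depth (refl i q) = depth q + 1 ∨
      wall i q < 0 ∧ depth (refl i q) + 1 = depth q := by
  obtain ⟨x, y⟩ := q
  simp only [IsCenter] at h
  fin_cases i
  · have h₁ : 0 < x ∧ (-x / 3).natAbs = (x / 3).natAbs + 1 ∨
        x < 0 ∧ (-x / 3).natAbs + 1 = (x / 3).natAbs := by omega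
    have h₂ : (-x + (x + y)) = y := by ring
    simp [wall, depth, refl, h₂]
    grind
  · have h₁ : 0 < y ∧ (-y / 3).natAbs = (y / 3).natAbs + 1 ∨
        y < 0 ∧ (-y / 3).natAbs + 1 = (y / 3).natAbs := by omega
    have h₂ : (x + y + -y) = x := by ring
    simp [wall, depth, refl, h₂]
    grind
  · have h₁ : ((3 - y) / 3).natAbs = (y / 3).natAbs := by omega
    have h₂ : ((3 - x) / 3).natAbs = (x / 3).natAbs := by omega
    have h₃ : 0 < 3 - x - y ∧ ((3 - y + (3 - x)) / 3).natAbs = ((x + y) / 3).natAbs + 1 ∨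
        3 - x - y < 0 ∧ ((3 - y + (3 - x)) / 3).natAbs + 1 = ((x + y) / 3).natAbs := by omega
    simp [wall, depth, refl, h₁, h₂]
    grind

theorem exists_wall_neg {q : ℤ × ℤ} (h : IsCenter q) (hq : q ≠ (1, 1)) : ∃ i, wall i q < 0 := by
  simp [Fin.exists_fin_succ, wall, IsCenter, Prod.ext_iff] at h hq ⊢
  omega

variable {W : Type*} [Group W] (cs : CoxeterSystem affineA2 W)

/-- The centre of the alcove `w A₀`. -/
abbrev center (w : W) : ℤ × ℤ :=
  cs.orbitMap isLiftable_refl (1, 1) w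

/-- Writing `w = t ^ a * u ^ b * w₀`, the centre of `w` is that of `w₀` shifted by a lattice vector.
The base point and its image under a nontrivial `w₀` are never congruent modulo the lattice, so `w₀
= 1`, and then `a = b = 0`. -/
theorem eq_one_of_center_eq {w : W} (hw : center cs w = (1, 1)) : w = 1 := by
  have ha := cs.simple_mul_simple_self 0
  have hb := cs.simple_mul_simple_self 1
  have hc := cs.simple_mul_simple_self 2
  have hab := CoxeterSystem.braid_three (cs := cs) (i := 0) (j := 1) rfl
  have hac := CoxeterSystem.braid_three (cs := cs) (i := 0) (j := 2) rfl
  have hbc := CoxeterSystem.braid_three (cs := cs) (i := 1) (j := 2) rfl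
  -- The product `s₁s₂s₁` is the linear part of the reflection `s₃`, so `t` is a translation; `u` is
  -- its conjugate by `s₁`.
  set t := cs.simple 2 * cs.simple 0 * cs.simple 1 * cs.simple 0 with ht
  set u := cs.simple 0 * cs.simple 2 * cs.simple 0 * cs.simple 1 with hu
  have htu : Commute t u := show t * u = u * t by grind
  have hbt : u * (cs.simple 1 * t) = t * cs.simple 1 := by grind
  have hbu : u * (cs.simple 1 * u) = cs.simple 1 := by grind
  -- The rows of `c` and `d` are the exponents of the conjugates of `t` and `u` by `s₁` and `s₂`.
  obtain ⟨a, b, w₀, hw₀, rfl⟩ := cs.exists_eq_zpow_mul_zpow_mul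
    (t := t) (u := u) (r := cs.simple 0 * (cs.simple 1 * cs.simple 0))
    (c := ![![0, 1], ![1, 0]]) (d := ![![1, -1], ![0, -1]]) htu
    (by simp; grind) (by simp; grind)
    (by simp [htu.inv_right.eq, mul_assoc, eq_inv_mul_iff_mul_eq, hbt])
    (by simp [eq_inv_mul_iff_mul_eq, hbu])
    (mul_mem (cs.simple_mem_parabolic (by simp)) (mul_mem (cs.simple_mem_parabolic (by simp))
      (cs.simple_mem_parabolic (by simp)))) (by grind) w
  have hT : ∀ g, center cs (t * g) = center cs g + (3, 3) := by
    intro g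
    simp [center, ht, refl, mul_assoc, Prod.ext_iff]
    omega
  have hU : ∀ g, center cs (u * g) = center cs g + (-3, 6) := by
    intro g
    simp [center, hu, refl, mul_assoc, Prod.ext_iff]
    omega
  rw [center, cs.orbitMap_zpow_mul _ _ hT, cs.orbitMap_zpow_mul _ _ hU] at hw
  rcases CoxeterSystem.mem_of_mem_parabolic_three rfl hw₀ with rfl | rfl | rfl | rfl | rfl | rfl <;>
    simp [refl, Prod.ext_iff] at hw
  all_goals first
    | omega
    | obtain ⟨rfl, rfl⟩ : a = 0 ∧ b = 0 := by omega
      simp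

theorem center_injective : Function.Injective (center cs) :=
  cs.orbitMap_injective _ _ fun _ => eq_one_of_center_eq cs

theorem isCenter_and_length_eq (w : W) :
    IsCenter (center cs w) ∧ cs.length w = depth (center cs w) := by
  exact cs.length_eq_of_wall _ _ (fun _ => eq_one_of_center_eq cs) (by simp [IsCenter])
    (by decide) (fun i q h => h.refl i) (fun i q h => depth_refl h i)
    (fun q h => exists_wall_neg h) w

theorem isCenter (w : W) : IsCenter (center cs w) :=
  (isCenter_and_length_eq cs w).1

theorem length_simple_mul (w : W) (i : Fin 3) :
    0 < wall i (center cs w) ∧ cs.length (cs.simple i * w) = cs.length w + 1 ∨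
      wall i (center cs w) < 0 ∧ cs.length (cs.simple i * w) + 1 = cs.length w := by
  rw [(isCenter_and_length_eq cs w).2, (isCenter_and_length_eq cs _).2]
  simpa [center] using depth_refl (isCenter cs w) i

theorem length_eq (w : W) : cs.length w = depth (center cs w) :=
  (isCenter_and_length_eq cs w).2

/-- With the parabolic subgroup listed explicitly, the descent condition is checked word by word
through `depth`. -/
theorem minLeftCosetReps_zero_one : cs.minLeftCosetReps {0, 1} {1} =
    {1, cs.simple 0, cs.simple 1 * cs.simple 0} := by
  have h0 : cs.simple 0 ∈ cs.parabolic {0, 1} := cs.simple_mem_parabolic (by simp)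
  have h1 : cs.simple 1 ∈ cs.parabolic {0, 1} := cs.simple_mem_parabolic (by simp)
  ext w
  constructor
  · rintro ⟨hw, hl⟩
    have hl := hl 1 rfl
    rw [length_eq, length_eq] at hl
    rcases CoxeterSystem.mem_of_mem_parabolic_three rfl hw with
      rfl | rfl | rfl | rfl | rfl | rfl <;>
      simp [center, refl, depth, mul_assoc] at hl ⊢
  · rintro (rfl | rfl | rfl)
    · exact ⟨one_mem _, by simp⟩
    · exact ⟨h0, by simp [length_eq, center, refl, depth]⟩
    · exact ⟨mul_mem h1 h0, by simp [length_eq, center, refl, depth, mul_assoc]⟩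

theorem minLeftCosetReps_one_two : cs.minLeftCosetReps {1, 2} {2} =
    {1, cs.simple 1, cs.simple 2 * cs.simple 1} := by
  have h1 : cs.simple 1 ∈ cs.parabolic {1, 2} := cs.simple_mem_parabolic (by simp)
  have h2 : cs.simple 2 ∈ cs.parabolic {1, 2} := cs.simple_mem_parabolic (by simp)
  ext w
  constructor
  · rintro ⟨hw, hl⟩
    have hl := hl 2 rfl
    rw [length_eq, length_eq] at hl
    rcases CoxeterSystem.mem_of_mem_parabolic_three rfl hw with
      rfl | rfl | rfl | rfl | rfl | rfl <;>
      simp [center, refl, depth, mul_assoc] at hl ⊢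
  · rintro (rfl | rfl | rfl)
    · exact ⟨one_mem _, by simp⟩
    · exact ⟨h1, by simp [length_eq, center, refl, depth]⟩
    · exact ⟨mul_mem h2 h1, by simp [length_eq, center, refl, depth, mul_assoc]⟩

theorem minRightCosetReps_zero_two : cs.minRightCosetReps {0} {0, 2} =
    {1, cs.simple 2, cs.simple 2 * cs.simple 0} := by
  have h0 : cs.simple 0 ∈ cs.parabolic {0, 2} := cs.simple_mem_parabolic (by simp)
  have h2 : cs.simple 2 ∈ cs.parabolic {0, 2} := cs.simple_mem_parabolic (by simp)
  ext w
  constructor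
  · rintro ⟨hw, hl⟩
    have hl := hl 0 rfl
    rw [length_eq, length_eq] at hl
    rcases CoxeterSystem.mem_of_mem_parabolic_three rfl hw with
      rfl | rfl | rfl | rfl | rfl | rfl <;>
      simp [center, refl, depth] at hl ⊢
  · rintro (rfl | rfl | rfl)
    · exact ⟨one_mem _, by simp⟩
    · exact ⟨h2, by simp [length_eq, center, refl, depth]⟩
    · exact ⟨mul_mem h2 h0, by simp [length_eq, center, refl, depth]⟩

/-- The alcoves in the union of the two Weyl chambers adjacent along the wall `y = 0`. -/
def doubleChamber : Set W :=
  {w | 0 < (center cs w).1 ∧ 0 < (center cs w).1 + (center cs w).2}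

/-- The alcoves in the dominant chamber between the walls `x = 0` and `x = 3`. -/
def strip : Set W :=
  {w | 0 < (center cs w).1 ∧ (center cs w).1 < 3 ∧ 0 < (center cs w).2}

/-- The union of the three half-strips `strip`, `s₂ strip` and `s₃s₂ strip`. -/
def tripod : Set W :=
  {w | 0 < (center cs w).1 ∧ (center cs w).1 < 3 ∧ 0 < (center cs w).2 ∨
    0 < (center cs w).1 + (center cs w).2 ∧ (center cs w).1 + (center cs w).2 < 3 ∧
      (center cs w).2 < 0 ∨
    3 < (center cs w).1 + (center cs w).2 ∧ (center cs w).1 + (center cs w).2 < 6 ∧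
      3 < (center cs w).1}

/-- Each letter of a representative crosses a wall from its positive side: `x > 0` at `g`, then `x +
y > 0` at `s₁g`. The three double chambers cover everything because no centre lies on a wall. -/
theorem isReducedProduct_univ :
    cs.IsReducedProduct {1, cs.simple 0, cs.simple 1 * cs.simple 0} (doubleChamber cs)
      Set.univ := by
  refine CoxeterSystem.IsReducedProduct.of_translates ?_ ?_ ?_
  · rintro a ha g hg
    refine ⟨trivial, ?_⟩
    have h₁ := length_simple_mul cs g 0
    have h₂ := length_simple_mul cs (cs.simple 0 * g) 1
    rcases ha with rfl | rfl | rfl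
    · simp
    · simp [doubleChamber, center, wall, refl] at *
      omega
    · have : cs.length (cs.simple 1 * cs.simple 0) = 2 := by
        simp [length_eq, center, refl, depth]
      simp [doubleChamber, center, wall, refl, mul_assoc, this] at *
      omega
  · rintro a (rfl | rfl | rfl) a' (rfl | rfl | rfl) g hg hg' <;>
      simp [doubleChamber, center, refl, mul_assoc] at hg hg' ⊢ <;> omega
  · intro g _
    have := isCenter cs g
    simp [doubleChamber, IsCenter, center, refl, mul_assoc] at *
    omega

/-- Here `w₁` acts by `(x, y) ↦ (x + y + 3, 3 - y)`, so the image of the double chamber is `x > 3`,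
`x + y > 6`, and what remains is the tripod. -/
theorem isReducedProduct_doubleChamber :
    cs.IsReducedProduct (nonnegPowers (cs.simple 2 * cs.simple 1 * cs.simple 0)) (tripod cs)
      (doubleChamber cs) := by
  have hl : cs.length (cs.simple 2 * cs.simple 1 * cs.simple 0) = 3 := by
    simp [length_eq, center, refl, depth, mul_assoc]
  refine CoxeterSystem.IsReducedProduct.nonnegPowers ?_ ?_ ?_ ?_ ?_
  · intro h
    simp [h] at hl
  · simp [doubleChamber, center]
  · intro g hg
    have h₀ := isCenter cs g
    have h₁ := length_simple_mul cs g 0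
    have h₂ := length_simple_mul cs (cs.simple 0 * g) 1
    have h₃ := length_simple_mul cs (cs.simple 1 * (cs.simple 0 * g)) 2
    simp [doubleChamber, IsCenter, center, wall, refl, mul_assoc] at *
    omega
  · intro g hg
    simp [doubleChamber, tripod, center, refl, mul_assoc] at *
    omega
  · intro g hg
    have h₀ := isCenter cs g
    simp [doubleChamber, tripod, IsCenter, center, refl, mul_assoc] at *
    omega

theorem isReducedProduct_tripod :
    cs.IsReducedProduct {1, cs.simple 1, cs.simple 2 * cs.simple 1} (strip cs) (tripod cs) := by
  refine CoxeterSystem.IsReducedProduct.of_translates ?_ ?_ ?_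
  · rintro a ha g hg
    have h₁ := length_simple_mul cs g 1
    have h₂ := length_simple_mul cs (cs.simple 1 * g) 2
    have : cs.length (cs.simple 2 * cs.simple 1) = 2 := by
      simp [length_eq, center, refl, depth]
    rcases ha with rfl | rfl | rfl <;>
      simp [strip, tripod, center, wall, refl, mul_assoc, this] at * <;> omega
  · rintro a (rfl | rfl | rfl) a' (rfl | rfl | rfl) g hg hg' <;>
      simp [strip, center, refl, mul_assoc] at hg hg' ⊢ <;> omega
  · intro g hg
    have := isCenter cs g
    simp [strip, tripod, IsCenter, center, refl, mul_assoc] at *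
    omega

/-- Injectivity of `center` turns membership in a finite set of group elements into a condition on
coordinates. -/
theorem mem_reps_iff {w : W} : w ∈ ({1, cs.simple 2, cs.simple 2 * cs.simple 0} : Set W) ↔
    center cs w = (1, 1) ∨ center cs w = (2, 2) ∨ center cs w = (1, 4) := by
  have h₀ : center cs 1 = (1, 1) := by simp [center]
  have h₁ : center cs (cs.simple 2) = (2, 2) := by simp [center, refl]
  have h₂ : center cs (cs.simple 2 * cs.simple 0) = (1, 4) := by simp [center, refl]
  rw [← h₀, ← h₁, ← h₂]
  simp only [(center_injective cs).eq_iff]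
  rfl

/-- Here `w₂` is the glide reflection `(x, y) ↦ (3 - x, x + y + 3)`. It sends the half-strip to its
part with `x + y > 6`; the three centres below that line are the representatives. -/
theorem isReducedProduct_strip :
    cs.IsReducedProduct (nonnegPowers (cs.simple 2 * cs.simple 0 * cs.simple 1))
      {1, cs.simple 2, cs.simple 2 * cs.simple 0} (strip cs) := by
  have hl : cs.length (cs.simple 2 * cs.simple 0 * cs.simple 1) = 3 := by
    simp [length_eq, center, refl, depth, mul_assoc]
  refine CoxeterSystem.IsReducedProduct.nonnegPowers ?_ ?_ ?_ ?_ ?_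
  · intro h
    simp [h] at hl
  · simp [strip, center]
  · intro g hg
    have h₀ := isCenter cs g
    have h₁ := length_simple_mul cs g 1
    have h₂ := length_simple_mul cs (cs.simple 1 * g) 0
    have h₃ := length_simple_mul cs (cs.simple 0 * (cs.simple 1 * g)) 2
    simp [strip, IsCenter, center, wall, refl, mul_assoc] at *
    omega
  · intro g hg
    rw [mem_reps_iff] at hg
    simp [strip, center, refl, mul_assoc, Prod.ext_iff] at *
    omega
  · intro g hg
    have h₀ := isCenter cs g
    rw [mem_reps_iff]
    simp [strip, IsCenter, center, refl, mul_assoc, Prod.ext_iff] at *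
    omega

theorem poincareSeries_and_isFactorization :
    (∏ i, cs.poincareSeries (factorsA2 cs i)) = cs.poincareSeries Set.univ ∧
      IsFactorization (factorsA2 cs) := by
  rw [factorsA2, minLeftCosetReps_zero_one, minLeftCosetReps_one_two, minRightCosetReps_zero_two]
  have h₁ := isReducedProduct_univ cs
  have h₂ := isReducedProduct_doubleChamber cs
  have h₃ := isReducedProduct_tripod cs
  have h₄ := isReducedProduct_strip cs
  constructor
  · rw [← h₁.poincareSeries_eq, ← h₂.poincareSeries_eq, ← h₃.poincareSeries_eq,
      ← h₄.poincareSeries_eq]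
    simp [Fin.prod_univ_succ]
  · have := h₁.factorizesSet (h₂.factorizesSet (h₃.factorizesSet (h₄.factorizesSet
      (CoxeterSystem.factorizesSet_singleton _))))
    exact fun w => this.2 w trivial

end AffineA2

/-! ### Type C̃₂ -/

namespace AffineC2

/-- The generators of type `C̃₂` as affine reflections, in orthogonal coordinates, scaled such that the
fundamental alcove is bounded by `x = y`, `y = 0` and `x = 3`. -/
def refl : Fin 3 → ℤ × ℤ → ℤ × ℤ :=
  ![fun q => (q.2, q.1), fun q => (q.1, -q.2), fun q => (6 - q.1, q.2)]

theorem isLiftable_refl : affineC2.IsLiftable (G := Function.End (ℤ × ℤ)) refl := by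
  intro i j
  funext ⟨x, y⟩
  change ((refl i ∘ refl j)^[affineC2.M i j]) (x, y) = (x, y)
  fin_cases i <;> fin_cases j <;> simp [affineC2, refl]

/-- The centres of the alcoves. -/
def IsCenter (q : ℤ × ℤ) : Prop :=
  (q.1 % 6 = 1 ∨ q.1 % 6 = 5) ∧ (q.2 % 6 = 2 ∨ q.2 % 6 = 4) ∨
    (q.1 % 6 = 2 ∨ q.1 % 6 = 4) ∧ (q.2 % 6 = 1 ∨ q.2 % 6 = 5)

/-- The number of walls between the fundamental alcove and the alcove of `q`. -/
def depth (q : ℤ × ℤ) : ℕ :=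
  (q.1 / 3).natAbs + (q.2 / 3).natAbs + ((q.1 + q.2) / 6).natAbs + ((q.1 - q.2) / 6).natAbs

/-- The affine functions that are positive on the fundamental alcove and vanish on its walls. -/
def wall : Fin 3 → ℤ × ℤ → ℤ :=
  ![fun q => q.1 - q.2, fun q => q.2, fun q => 3 - q.1]

theorem IsCenter.refl {q : ℤ × ℤ} (h : IsCenter q) (i : Fin 3) : IsCenter (refl i q) := by
  fin_cases i <;> simp [IsCenter, AffineC2.refl] at h ⊢ <;> omega

theorem depth_refl {q : ℤ × ℤ} (h : IsCenter q) (i : Fin 3) :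
    0 < wall i q ∧ depth (refl i q) = depth q + 1 ∨
      wall i q < 0 ∧ depth (refl i q) + 1 = depth q := by
  obtain ⟨x, y⟩ := q
  simp only [IsCenter] at h
  fin_cases i
  · have h₁ : 0 < x - y ∧ ((y - x) / 6).natAbs = ((x - y) / 6).natAbs + 1 ∨
        x - y < 0 ∧ ((y - x) / 6).natAbs + 1 = ((x - y) / 6).natAbs := by omega
    simp [wall, depth, refl, add_comm y x]
    grind
  · have h₁ : 0 < y ∧ (-y / 3).natAbs = (y / 3).natAbs + 1 ∨
        y < 0 ∧ (-y / 3).natAbs + 1 = (y / 3).natAbs := by omega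
    simp [wall, depth, refl, ← sub_eq_add_neg]
    grind
  · have h₁ : ((6 - x + y) / 6).natAbs = ((x - y) / 6).natAbs := by omega
    have h₂ : ((6 - x - y) / 6).natAbs = ((x + y) / 6).natAbs := by omega
    have h₃ : 0 < 3 - x ∧ ((6 - x) / 3).natAbs = (x / 3).natAbs + 1 ∨
        3 - x < 0 ∧ ((6 - x) / 3).natAbs + 1 = (x / 3).natAbs := by omega
    simp [wall, depth, refl, h₁, h₂]
    grind

theorem exists_wall_neg {q : ℤ × ℤ} (h : IsCenter q) (hq : q ≠ (2, 1)) : ∃ i, wall i q < 0 := by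
  simp [Fin.exists_fin_succ, wall, IsCenter, Prod.ext_iff] at h hq ⊢
  omega

variable {W : Type*} [Group W] (cs : CoxeterSystem affineC2 W)

/-- The centre of the alcove `w A₀`. -/
abbrev center (w : W) : ℤ × ℤ :=
  cs.orbitMap isLiftable_refl (2, 1) w

theorem eq_one_of_center_eq {w : W} (hw : center cs w = (2, 1)) : w = 1 := by
  have ha := cs.simple_mul_simple_self 0
  have hb := cs.simple_mul_simple_self 1
  have hc := cs.simple_mul_simple_self 2
  have hab := CoxeterSystem.braid_four (cs := cs) (i := 0) (j := 1) rfl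
  have hac := CoxeterSystem.braid_four (cs := cs) (i := 0) (j := 2) rfl
  have hbc := CoxeterSystem.braid_two (cs := cs) (i := 1) (j := 2) rfl
  have hcab := congrArg (cs.simple 2 * ·) hab
  have hacb := congrArg (· * cs.simple 1) hac
  -- As linear maps `s₁s₂s₁` is `(x, y) ↦ (-x, y)`, the linear part of `s₃`; hence `t` and `u =
  -- s₁ts₁` are the translations by 6 along the two axes.
  set t := cs.simple 2 * cs.simple 0 * cs.simple 1 * cs.simple 0 with ht
  set u := cs.simple 0 * cs.simple 2 * cs.simple 0 * cs.simple 1 with hu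
  have htu : Commute t u := show t * u = u * t by grind
  have hbt : cs.simple 1 * t = t * cs.simple 1 := by grind
  have hbu : u * (cs.simple 1 * u) = cs.simple 1 := by grind
  obtain ⟨a, b, w₀, hw₀, rfl⟩ := cs.exists_eq_zpow_mul_zpow_mul
    (t := t) (u := u) (r := cs.simple 0 * (cs.simple 1 * cs.simple 0))
    (c := ![![0, 1], ![1, 0]]) (d := ![![1, 0], ![0, -1]]) htu
    (by simp; grind) (by simp; grind)
    (by simp [hbt])
    (by simp [eq_inv_mul_iff_mul_eq, hbu])
    (mul_mem (cs.simple_mem_parabolic (by simp)) (mul_mem (cs.simple_mem_parabolic (by simp))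
      (cs.simple_mem_parabolic (by simp)))) (by grind) w
  have hT : ∀ g, center cs (t * g) = center cs g + (6, 0) := by
    intro g
    simp [center, ht, refl, mul_assoc, Prod.ext_iff]
    omega
  have hU : ∀ g, center cs (u * g) = center cs g + (0, 6) := by
    intro g
    simp [center, hu, refl, mul_assoc, Prod.ext_iff]
    omega
  rw [center, cs.orbitMap_zpow_mul _ _ hT, cs.orbitMap_zpow_mul _ _ hU] at hw
  rcases CoxeterSystem.mem_of_mem_parabolic_four rfl hw₀ with
      rfl | rfl | rfl | rfl | rfl | rfl | rfl | rfl <;>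
    simp [refl, Prod.ext_iff] at hw
  all_goals first
    | omega
    | obtain ⟨rfl, rfl⟩ : a = 0 ∧ b = 0 := by omega
      simp

theorem center_injective : Function.Injective (center cs) :=
  cs.orbitMap_injective _ _ fun _ => eq_one_of_center_eq cs

theorem isCenter_and_length_eq (w : W) :
    IsCenter (center cs w) ∧ cs.length w = depth (center cs w) := by
  exact cs.length_eq_of_wall _ _ (fun _ => eq_one_of_center_eq cs) (by simp [IsCenter])
    (by decide) (fun i q h => h.refl i) (fun i q h => depth_refl h i)
    (fun q h => exists_wall_neg h) w

theorem isCenter (w : W) : IsCenter (center cs w) :=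
  (isCenter_and_length_eq cs w).1

theorem length_simple_mul (w : W) (i : Fin 3) :
    0 < wall i (center cs w) ∧ cs.length (cs.simple i * w) = cs.length w + 1 ∨
      wall i (center cs w) < 0 ∧ cs.length (cs.simple i * w) + 1 = cs.length w := by
  rw [(isCenter_and_length_eq cs w).2, (isCenter_and_length_eq cs _).2]
  simpa [center] using depth_refl (isCenter cs w) i

theorem length_eq (w : W) : cs.length w = depth (center cs w) :=
  (isCenter_and_length_eq cs w).2

theorem minLeftCosetReps_zero_one : cs.minLeftCosetReps {0, 1} {1} =
    {1, cs.simple 0, cs.simple 1 * cs.simple 0, cs.simple 0 * (cs.simple 1 * cs.simple 0)} := by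
  have h0 : cs.simple 0 ∈ cs.parabolic {0, 1} := cs.simple_mem_parabolic (by simp)
  have h1 : cs.simple 1 ∈ cs.parabolic {0, 1} := cs.simple_mem_parabolic (by simp)
  ext w
  constructor
  · rintro ⟨hw, hl⟩
    have hl := hl 1 rfl
    rw [length_eq, length_eq] at hl
    rcases CoxeterSystem.mem_of_mem_parabolic_four rfl hw with
      rfl | rfl | rfl | rfl | rfl | rfl | rfl | rfl <;>
      simp [center, refl, depth, mul_assoc] at hl ⊢
  · rintro (rfl | rfl | rfl | rfl)
    · exact ⟨one_mem _, by simp⟩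
    · exact ⟨h0, by simp [length_eq, center, refl, depth]⟩
    · exact ⟨mul_mem h1 h0, by simp [length_eq, center, refl, depth, mul_assoc]⟩
    · exact ⟨mul_mem h0 (mul_mem h1 h0), by simp [length_eq, center, refl, depth, mul_assoc]⟩

theorem minLeftCosetReps_one_two : cs.minLeftCosetReps {1, 2} {2} =
    {1, cs.simple 1} := by
  have h1 : cs.simple 1 ∈ cs.parabolic {1, 2} := cs.simple_mem_parabolic (by simp)
  ext w
  constructor
  · rintro ⟨hw, hl⟩
    have hl := hl 2 rfl
    rw [length_eq, length_eq] at hl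
    rcases CoxeterSystem.mem_of_mem_parabolic_two rfl hw with
      rfl | rfl | rfl | rfl <;>
      simp [center, refl, depth, mul_assoc] at hl ⊢
  · rintro (rfl | rfl)
    · exact ⟨one_mem _, by simp⟩
    · exact ⟨h1, by simp [length_eq, center, refl, depth]⟩

theorem minRightCosetReps_zero_two : cs.minRightCosetReps {0} {0, 2} =
    {1, cs.simple 2, cs.simple 2 * cs.simple 0, cs.simple 2 * (cs.simple 0 * cs.simple 2)} := by
  have h0 : cs.simple 0 ∈ cs.parabolic {0, 2} := cs.simple_mem_parabolic (by simp)
  have h2 : cs.simple 2 ∈ cs.parabolic {0, 2} := cs.simple_mem_parabolic (by simp)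
  ext w
  constructor
  · rintro ⟨hw, hl⟩
    have hl := hl 0 rfl
    rw [length_eq, length_eq] at hl
    rcases CoxeterSystem.mem_of_mem_parabolic_four rfl hw with
      rfl | rfl | rfl | rfl | rfl | rfl | rfl | rfl <;>
      simp [center, refl, depth] at hl ⊢
  · rintro (rfl | rfl | rfl | rfl)
    · exact ⟨one_mem _, by simp⟩
    · exact ⟨h2, by simp [length_eq, center, refl, depth]⟩
    · exact ⟨mul_mem h2 h0, by simp [length_eq, center, refl, depth]⟩
    · exact ⟨mul_mem h2 (mul_mem h0 h2), by simp [length_eq, center, refl, depth]⟩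

/-- The alcoves in the union of the two Weyl chambers adjacent along the wall `y = 0`. -/
def doubleChamber : Set W :=
  {w | 0 < (center cs w).1 + (center cs w).2 ∧ 0 < (center cs w).1 - (center cs w).2}

/-- The alcoves in the dominant chamber between the walls `x - y = 0` and `x - y = 6`. -/
def strip : Set W :=
  {w | 0 < (center cs w).1 - (center cs w).2 ∧ (center cs w).1 - (center cs w).2 < 6 ∧
    0 < (center cs w).2}

/-- The union of the half-strips `strip` and `s₂ strip`. -/
def bipod : Set W :=
  {w | 0 < (center cs w).1 - (center cs w).2 ∧ (center cs w).1 - (center cs w).2 < 6 ∧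
      0 < (center cs w).2 ∨
    0 < (center cs w).1 + (center cs w).2 ∧ (center cs w).1 + (center cs w).2 < 6 ∧
      (center cs w).2 < 0}

theorem isReducedProduct_univ :
    cs.IsReducedProduct {1, cs.simple 0, cs.simple 1 * cs.simple 0,
      cs.simple 0 * (cs.simple 1 * cs.simple 0)} (doubleChamber cs) Set.univ := by
  have hl₂ : cs.length (cs.simple 1 * cs.simple 0) = 2 := by
    simp [length_eq, center, refl, depth]
  have hl₃ : cs.length (cs.simple 0 * (cs.simple 1 * cs.simple 0)) = 3 := by
    simp [length_eq, center, refl, depth]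
  refine CoxeterSystem.IsReducedProduct.of_translates ?_ ?_ ?_
  · rintro a ha g hg
    refine ⟨trivial, ?_⟩
    have h₁ := length_simple_mul cs g 0
    have h₂ := length_simple_mul cs (cs.simple 0 * g) 1
    have h₃ := length_simple_mul cs (cs.simple 1 * (cs.simple 0 * g)) 0
    rcases ha with rfl | rfl | rfl | rfl <;>
      simp [doubleChamber, center, wall, refl, mul_assoc, hl₂, hl₃] at * <;> omega
  · rintro a (rfl | rfl | rfl | rfl) a' (rfl | rfl | rfl | rfl) g hg hg' <;>
      simp [doubleChamber, center, refl, mul_assoc] at hg hg' ⊢ <;> omega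
  · intro g _
    have := isCenter cs g
    simp [doubleChamber, IsCenter, center, refl, mul_assoc] at *
    omega

/-- Here `w₁` is the translation by `(6, 0)`. In the double chamber `|y| < x` it misses the centres
with `x < |y| + 6`: one half-strip for each sign of `y`. -/
theorem isReducedProduct_doubleChamber :
    cs.IsReducedProduct
      (nonnegPowers (cs.simple 2 * cs.simple 0 * cs.simple 1 * cs.simple 0)) (bipod cs)
      (doubleChamber cs) := by
  have hl : cs.length (cs.simple 2 * cs.simple 0 * cs.simple 1 * cs.simple 0) = 4 := by
    simp [length_eq, center, refl, depth, mul_assoc]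
  refine CoxeterSystem.IsReducedProduct.nonnegPowers ?_ ?_ ?_ ?_ ?_
  · intro h
    simp [h] at hl
  · simp [doubleChamber, center]
  · intro g hg
    have h₁ := length_simple_mul cs g 0
    have h₂ := length_simple_mul cs (cs.simple 0 * g) 1
    have h₃ := length_simple_mul cs (cs.simple 1 * (cs.simple 0 * g)) 0
    have h₄ := length_simple_mul cs (cs.simple 0 * (cs.simple 1 * (cs.simple 0 * g))) 2
    simp [doubleChamber, center, wall, refl, mul_assoc] at *
    omega
  · intro g hg
    simp [doubleChamber, bipod, center, refl, mul_assoc] at *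
    omega
  · intro g hg
    have h₀ := isCenter cs g
    simp [doubleChamber, bipod, IsCenter, center, refl, mul_assoc] at *
    omega

theorem isReducedProduct_bipod :
    cs.IsReducedProduct {1, cs.simple 1} (strip cs) (bipod cs) := by
  refine CoxeterSystem.IsReducedProduct.of_translates ?_ ?_ ?_
  · rintro a ha g hg
    have h₁ := length_simple_mul cs g 1
    rcases ha with rfl | rfl <;> simp [strip, bipod, center, wall, refl] at * <;> omega
  · rintro a (rfl | rfl) a' (rfl | rfl) g hg hg' <;>
      simp [strip, center, refl] at hg hg' ⊢ <;> omega
  · intro g hg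
    have := isCenter cs g
    simp [strip, bipod, IsCenter, center, refl] at *
    omega

theorem mem_reps_iff {w : W} : w ∈ ({1, cs.simple 2, cs.simple 2 * cs.simple 0,
      cs.simple 2 * (cs.simple 0 * cs.simple 2)} : Set W) ↔
    center cs w = (2, 1) ∨ center cs w = (4, 1) ∨ center cs w = (5, 2) ∨
      center cs w = (5, 4) := by
  have h₀ : center cs 1 = (2, 1) := by simp [center]
  have h₁ : center cs (cs.simple 2) = (4, 1) := by simp [center, refl]
  have h₂ : center cs (cs.simple 2 * cs.simple 0) = (5, 2) := by simp [center, refl]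
  have h₃ : center cs (cs.simple 2 * (cs.simple 0 * cs.simple 2)) = (5, 4) := by
    simp [center, refl]
  rw [← h₀, ← h₁, ← h₂, ← h₃]
  simp only [(center_injective cs).eq_iff]
  rfl

/-- Here `w₂` acts by `(x, y) ↦ (y + 6, x)`, whose image of the half-strip is the part with `x > 6`;
four centres remain. -/
theorem isReducedProduct_strip :
    cs.IsReducedProduct (nonnegPowers (cs.simple 2 * cs.simple 0 * cs.simple 1))
      {1, cs.simple 2, cs.simple 2 * cs.simple 0, cs.simple 2 * (cs.simple 0 * cs.simple 2)}
      (strip cs) := by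
  have hl : cs.length (cs.simple 2 * cs.simple 0 * cs.simple 1) = 3 := by
    simp [length_eq, center, refl, depth, mul_assoc]
  refine CoxeterSystem.IsReducedProduct.nonnegPowers ?_ ?_ ?_ ?_ ?_
  · intro h
    simp [h] at hl
  · simp [strip, center]
  · intro g hg
    have h₁ := length_simple_mul cs g 1
    have h₂ := length_simple_mul cs (cs.simple 1 * g) 0
    have h₃ := length_simple_mul cs (cs.simple 0 * (cs.simple 1 * g)) 2
    simp [strip, center, wall, refl, mul_assoc] at *
    omega
  · intro g hg
    rw [mem_reps_iff] at hg
    simp [strip, center, refl, mul_assoc, Prod.ext_iff] at *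
    omega
  · intro g hg
    have h₀ := isCenter cs g
    rw [mem_reps_iff]
    simp [strip, IsCenter, center, refl, mul_assoc, Prod.ext_iff] at *
    omega

theorem poincareSeries_and_isFactorization :
    (∏ i, cs.poincareSeries (factorsC2 cs i)) = cs.poincareSeries Set.univ ∧
      IsFactorization (factorsC2 cs) := by
  rw [factorsC2, minLeftCosetReps_zero_one, minLeftCosetReps_one_two, minRightCosetReps_zero_two]
  have h₁ := isReducedProduct_univ cs
  have h₂ := isReducedProduct_doubleChamber cs
  have h₃ := isReducedProduct_bipod cs
  have h₄ := isReducedProduct_strip cs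
  constructor
  · rw [← h₁.poincareSeries_eq, ← h₂.poincareSeries_eq, ← h₃.poincareSeries_eq,
      ← h₄.poincareSeries_eq]
    simp [Fin.prod_univ_succ]
  · have := h₁.factorizesSet (h₂.factorizesSet (h₃.factorizesSet (h₄.factorizesSet
      (CoxeterSystem.factorizesSet_singleton _))))
    exact fun w => this.2 w trivial

end AffineC2

/-! ### Type G̃₂ -/

namespace AffineG2

/-- The generators of type `G̃₂` as affine reflections, in the coordinates given by the simple roots,
scaled such that the fundamental alcove is bounded by `x = 0`, `y = 0` and `2x + 3y = 6`. -/
def refl : Fin 3 → ℤ × ℤ → ℤ × ℤ :=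
  ![fun q => (-q.1, q.1 + q.2), fun q => (q.1 + 3 * q.2, -q.2),
    fun q => (6 - q.1 - 3 * q.2, q.2)]

theorem isLiftable_refl : affineG2.IsLiftable (G := Function.End (ℤ × ℤ)) refl := by
  intro i j
  funext ⟨x, y⟩
  change ((refl i ∘ refl j)^[affineG2.M i j]) (x, y) = (x, y)
  fin_cases i <;> fin_cases j <;> simp [affineG2, refl] <;> ring_nf <;> trivial

/-- The centres of the alcoves. -/
def IsCenter (q : ℤ × ℤ) : Prop :=
  q.1 % 6 ≠ 0 ∧ q.2 % 6 ≠ 0 ∧ (q.1 + q.2) % 6 ≠ 0 ∧ (q.1 + 2 * q.2) % 6 ≠ 0 ∧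
    (q.1 + 3 * q.2) % 6 ≠ 0 ∧ (2 * q.1 + 3 * q.2) % 6 ≠ 0

/-- The number of walls between the fundamental alcove and the alcove of `q`. -/
def depth (q : ℤ × ℤ) : ℕ :=
  (q.1 / 6).natAbs + (q.2 / 6).natAbs + ((q.1 + q.2) / 6).natAbs + ((q.1 + 2 * q.2) / 6).natAbs +
    ((q.1 + 3 * q.2) / 6).natAbs + ((2 * q.1 + 3 * q.2) / 6).natAbs

/-- The affine functions that are positive on the fundamental alcove and vanish on its walls. -/
def wall : Fin 3 → ℤ × ℤ → ℤ :=
  ![fun q => q.1, fun q => q.2, fun q => 6 - 2 * q.1 - 3 * q.2]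

theorem IsCenter.refl {q : ℤ × ℤ} (h : IsCenter q) (i : Fin 3) : IsCenter (refl i q) := by
  obtain ⟨h₁, h₂, h₃, h₄, h₅, h₆⟩ := h
  fin_cases i <;> simp only [IsCenter, AffineG2.refl] <;>
    refine ⟨?_, ?_, ?_, ?_, ?_, ?_⟩ <;> simp at * <;> omega

theorem depth_refl {q : ℤ × ℤ} (h : IsCenter q) (i : Fin 3) :
    0 < wall i q ∧ depth (refl i q) = depth q + 1 ∨
      wall i q < 0 ∧ depth (refl i q) + 1 = depth q := by
  obtain ⟨x, y⟩ := q
  obtain ⟨h₁, h₂, h₃, h₄, h₅, h₆⟩ := h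
  dsimp only at h₁ h₂ h₃ h₄ h₅ h₆
  fin_cases i
  · have e₁ : 0 < x ∧ (-x / 6).natAbs = (x / 6).natAbs + 1 ∨
        x < 0 ∧ (-x / 6).natAbs + 1 = (x / 6).natAbs := by
      clear h₂ h₃ h₄ h₅ h₆; omega
    have e₂ : -x + (x + y) = y := by ring
    have e₃ : -x + 2 * (x + y) = x + 2 * y := by ring
    have e₄ : -x + 3 * (x + y) = 2 * x + 3 * y := by ring
    have e₅ : 2 * -x + 3 * (x + y) = x + 3 * y := by ring
    simp only [wall, depth, AffineG2.refl, Fin.zero_eta, Matrix.cons_val, e₂, e₃, e₄, e₅]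
    clear h₁ h₂ h₃ h₄ h₅ h₆
    grind
  · have e₁ : 0 < y ∧ (-y / 6).natAbs = (y / 6).natAbs + 1 ∨
        y < 0 ∧ (-y / 6).natAbs + 1 = (y / 6).natAbs := by
      clear h₁ h₃ h₄ h₅ h₆; omega
    have e₂ : x + 3 * y + -y = x + 2 * y := by ring
    have e₃ : x + 3 * y + 2 * -y = x + y := by ring
    have e₄ : x + 3 * y + 3 * -y = x := by ring
    have e₅ : 2 * (x + 3 * y) + 3 * -y = 2 * x + 3 * y := by ring
    simp only [wall, depth, AffineG2.refl, Fin.mk_one, Matrix.cons_val, e₂, e₃, e₄, e₅]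
    clear h₁ h₂ h₃ h₄ h₅ h₆
    grind
  · have e₁ : ((6 - x - 3 * y) / 6).natAbs = ((x + 3 * y) / 6).natAbs := by
      clear h₁ h₂ h₃ h₄ h₆; omega
    have e₂ : ((6 - x - 3 * y + y) / 6).natAbs = ((x + 2 * y) / 6).natAbs := by
      clear h₁ h₂ h₃ h₅ h₆; omega
    have e₃ : ((6 - x - 3 * y + 2 * y) / 6).natAbs = ((x + y) / 6).natAbs := by
      clear h₁ h₂ h₄ h₅ h₆; omega
    have e₄ : ((6 - x - 3 * y + 3 * y) / 6).natAbs = (x / 6).natAbs := by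
      clear h₂ h₃ h₄ h₅ h₆; omega
    have e₅ : 2 * (6 - x - 3 * y) + 3 * y = 12 - (2 * x + 3 * y) := by ring
    have e₆ : 6 - 2 * x - 3 * y = 6 - (2 * x + 3 * y) := by ring
    -- Stated for one variable `z`, to be applied to `2x + 3y`, so that `omega` need not handle the
    -- linear form.
    have e₇ : ∀ z : ℤ, z % 6 ≠ 0 → 0 < 6 - z ∧ ((12 - z) / 6).natAbs = (z / 6).natAbs + 1 ∨
        6 - z < 0 ∧ ((12 - z) / 6).natAbs + 1 = (z / 6).natAbs := by
      clear h₁ h₂ h₃ h₄ h₅ h₆ e₁ e₂ e₃ e₄ e₅ e₆; omega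
    have e₈ := e₇ _ h₆
    simp only [wall, depth, AffineG2.refl, Fin.reduceFinMk, Matrix.cons_val, e₁, e₂, e₃, e₄, e₅, e₆]
    clear h₁ h₂ h₃ h₄ h₅ h₆ e₁ e₂ e₃ e₄ e₅ e₆ e₇
    grind

theorem exists_wall_neg {q : ℤ × ℤ} (h : IsCenter q) (hq : q ≠ (1, 1)) : ∃ i, wall i q < 0 := by
  simp [Fin.exists_fin_succ, wall, IsCenter, Prod.ext_iff] at h hq ⊢
  omega

variable {W : Type*} [Group W] (cs : CoxeterSystem affineG2 W)

/-- The centre of the alcove `w A₀`. -/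
abbrev center (w : W) : ℤ × ℤ :=
  cs.orbitMap isLiftable_refl (1, 1) w

theorem eq_one_of_center_eq {w : W} (hw : center cs w = (1, 1)) : w = 1 := by
  have ha := cs.simple_mul_simple_self 0
  have hb := cs.simple_mul_simple_self 1
  have hc := cs.simple_mul_simple_self 2
  have hab := CoxeterSystem.braid_six (cs := cs) (i := 0) (j := 1) rfl
  have hac := CoxeterSystem.braid_three (cs := cs) (i := 0) (j := 2) rfl
  have hbc := CoxeterSystem.braid_two (cs := cs) (i := 1) (j := 2) rfl
  have hcab := congrArg (cs.simple 2 * ·) hab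
  -- Again `t` is `s₃` times its linear part, now `s₁s₂s₁s₂s₁`, and `u = s₁ts₁`.
  set t := cs.simple 2 * cs.simple 0 * cs.simple 1 * cs.simple 0 * cs.simple 1 * cs.simple 0 with ht
  set u := cs.simple 0 * cs.simple 2 * cs.simple 0 * cs.simple 1 * cs.simple 0 * cs.simple 1 with hu
  have htu : Commute t u := show t * u = u * t by grind
  have hbt : cs.simple 1 * t = t * cs.simple 1 := by grind
  have hbu : u * (cs.simple 1 * u) = t * cs.simple 1 := by grind
  obtain ⟨a, b, w₀, hw₀, rfl⟩ := cs.exists_eq_zpow_mul_zpow_mul (t := t) (u := u)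
    (r := cs.simple 0 * (cs.simple 1 * (cs.simple 0 * (cs.simple 1 * cs.simple 0))))
    (c := ![![0, 1], ![1, 0]]) (d := ![![1, 0], ![1, -1]]) htu
    (by simp; grind) (by simp; grind) (by simp [hbt])
    (by simp [htu.inv_right.eq, mul_assoc, eq_inv_mul_iff_mul_eq, hbu])
    (by
      have h0 : cs.simple 0 ∈ cs.parabolic {0, 1} := cs.simple_mem_parabolic (by simp)
      have h1 : cs.simple 1 ∈ cs.parabolic {0, 1} := cs.simple_mem_parabolic (by simp)
      exact mul_mem h0 (mul_mem h1 (mul_mem h0 (mul_mem h1 h0))))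
    (by grind) w
  have hT : ∀ g, center cs (t * g) = center cs g + (6, 0) := by
    intro g
    simp [center, ht, refl, mul_assoc, Prod.ext_iff]
    omega
  have hU : ∀ g, center cs (u * g) = center cs g + (-6, 6) := by
    intro g
    simp [center, hu, refl, mul_assoc, Prod.ext_iff]
    omega
  rw [center, cs.orbitMap_zpow_mul _ _ hT, cs.orbitMap_zpow_mul _ _ hU] at hw
  rcases CoxeterSystem.mem_of_mem_parabolic_six rfl hw₀ with
      rfl | rfl | rfl | rfl | rfl | rfl | rfl | rfl | rfl | rfl | rfl | rfl <;>
    simp [refl, Prod.ext_iff] at hw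
  all_goals first
    | omega
    | obtain ⟨rfl, rfl⟩ : a = 0 ∧ b = 0 := by omega
      simp

theorem center_injective : Function.Injective (center cs) :=
  cs.orbitMap_injective _ _ fun _ => eq_one_of_center_eq cs

theorem isCenter_and_length_eq (w : W) :
    IsCenter (center cs w) ∧ cs.length w = depth (center cs w) := by
  exact cs.length_eq_of_wall _ _ (fun _ => eq_one_of_center_eq cs) (by simp [IsCenter])
    (by decide) (fun i q h => h.refl i) (fun i q h => depth_refl h i)
    (fun q h => exists_wall_neg h) w

theorem isCenter (w : W) : IsCenter (center cs w) :=
  (isCenter_and_length_eq cs w).1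

theorem length_simple_mul (w : W) (i : Fin 3) :
    0 < wall i (center cs w) ∧ cs.length (cs.simple i * w) = cs.length w + 1 ∨
      wall i (center cs w) < 0 ∧ cs.length (cs.simple i * w) + 1 = cs.length w := by
  rw [(isCenter_and_length_eq cs w).2, (isCenter_and_length_eq cs _).2]
  simpa [center] using depth_refl (isCenter cs w) i

theorem length_eq (w : W) : cs.length w = depth (center cs w) :=
  (isCenter_and_length_eq cs w).2

theorem minLeftCosetReps_one_zero : cs.minLeftCosetReps {1, 0} {0} =
    {1, cs.simple 1, cs.simple 0 * cs.simple 1, cs.simple 1 * (cs.simple 0 * cs.simple 1),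
      cs.simple 0 * (cs.simple 1 * (cs.simple 0 * cs.simple 1)),
      cs.simple 1 * (cs.simple 0 * (cs.simple 1 * (cs.simple 0 * cs.simple 1)))} := by
  have h0 : cs.simple 0 ∈ cs.parabolic {1, 0} := cs.simple_mem_parabolic (by simp)
  have h1 : cs.simple 1 ∈ cs.parabolic {1, 0} := cs.simple_mem_parabolic (by simp)
  ext w
  constructor
  · rintro ⟨hw, hl⟩
    have hl := hl 0 rfl
    rw [length_eq, length_eq] at hl
    rcases CoxeterSystem.mem_of_mem_parabolic_six rfl hw with
      rfl | rfl | rfl | rfl | rfl | rfl | rfl | rfl | rfl | rfl | rfl | rfl <;>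
      simp [center, refl, depth, mul_assoc] at hl ⊢
  · rintro (rfl | rfl | rfl | rfl | rfl | rfl)
    · exact ⟨one_mem _, by simp⟩
    · exact ⟨h1, by simp [length_eq, center, refl, depth]⟩
    · exact ⟨mul_mem h0 h1, by simp [length_eq, center, refl, depth, mul_assoc]⟩
    · exact ⟨mul_mem h1 (mul_mem h0 h1), by simp [length_eq, center, refl, depth, mul_assoc]⟩
    · exact ⟨mul_mem h0 (mul_mem h1 (mul_mem h0 h1)),
        by simp [length_eq, center, refl, depth, mul_assoc]⟩
    · exact ⟨mul_mem h1 (mul_mem h0 (mul_mem h1 (mul_mem h0 h1))),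
        by simp [length_eq, center, refl, depth, mul_assoc]⟩

theorem mem_parabolic_zero_two_iff {w : W} : w ∈ cs.parabolic {0, 2} ↔
    center cs w = (1, 1) ∨ center cs w = (-1, 2) ∨ center cs w = (2, 1) ∨
      center cs w = (-2, 3) ∨ center cs w = (1, 2) ∨ center cs w = (-1, 3) := by
  have h0 : cs.simple 0 ∈ cs.parabolic {0, 2} := cs.simple_mem_parabolic (by simp)
  have h2 : cs.simple 2 ∈ cs.parabolic {0, 2} := cs.simple_mem_parabolic (by simp)
  constructor
  · intro hw
    rcases CoxeterSystem.mem_of_mem_parabolic_three rfl hw with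
      rfl | rfl | rfl | rfl | rfl | rfl <;> simp [center, refl]
  · have h : ∀ v ∈ cs.parabolic {0, 2}, center cs w = center cs v → w ∈ cs.parabolic {0, 2} :=
      fun v hv h => center_injective cs h ▸ hv
    rintro (hw | hw | hw | hw | hw | hw)
    · exact h 1 (one_mem _) (hw.trans (by simp [center]))
    · exact h _ h0 (hw.trans (by simp [center, refl]))
    · exact h _ h2 (hw.trans (by simp [center, refl]))
    · exact h _ (mul_mem h0 h2) (hw.trans (by simp [center, refl]))
    · exact h _ (mul_mem h2 h0) (hw.trans (by simp [center, refl]))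
    · exact h _ (mul_mem h0 (mul_mem h2 h0)) (hw.trans (by simp [center, refl]))

/-- The alcoves in the union of the two Weyl chambers adjacent along the wall `x = 0`. -/
def doubleChamber : Set W :=
  {w | 0 < (center cs w).2 ∧ 0 < (center cs w).1 + (center cs w).2}

/-- The alcoves of `doubleChamber` below the wall `x + y = 6`. -/
def strip : Set W :=
  {w | 0 < (center cs w).2 ∧ 0 < (center cs w).1 + (center cs w).2 ∧
    (center cs w).1 + (center cs w).2 < 6}

theorem isReducedProduct_univ :
    cs.IsReducedProduct
      {1, cs.simple 1, cs.simple 0 * cs.simple 1, cs.simple 1 * (cs.simple 0 * cs.simple 1),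
        cs.simple 0 * (cs.simple 1 * (cs.simple 0 * cs.simple 1)),
        cs.simple 1 * (cs.simple 0 * (cs.simple 1 * (cs.simple 0 * cs.simple 1)))}
      (doubleChamber cs) Set.univ := by
  have hl₂ : cs.length (cs.simple 0 * cs.simple 1) = 2 := by
    simp [length_eq, center, refl, depth]
  have hl₃ : cs.length (cs.simple 1 * (cs.simple 0 * cs.simple 1)) = 3 := by
    simp [length_eq, center, refl, depth]
  have hl₄ : cs.length (cs.simple 0 * (cs.simple 1 * (cs.simple 0 * cs.simple 1))) = 4 := by
    simp [length_eq, center, refl, depth]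
  have hl₅ : cs.length
      (cs.simple 1 * (cs.simple 0 * (cs.simple 1 * (cs.simple 0 * cs.simple 1)))) = 5 := by
    simp [length_eq, center, refl, depth]
  refine CoxeterSystem.IsReducedProduct.of_translates ?_ ?_ ?_
  · rintro a ha g hg
    refine ⟨trivial, ?_⟩
    have h₁ := length_simple_mul cs g 1
    have h₂ := length_simple_mul cs (cs.simple 1 * g) 0
    have h₃ := length_simple_mul cs (cs.simple 0 * (cs.simple 1 * g)) 1
    have h₄ := length_simple_mul cs (cs.simple 1 * (cs.simple 0 * (cs.simple 1 * g))) 0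
    have h₅ := length_simple_mul cs
      (cs.simple 0 * (cs.simple 1 * (cs.simple 0 * (cs.simple 1 * g)))) 1
    rcases ha with rfl | rfl | rfl | rfl | rfl | rfl <;>
      simp [doubleChamber, center, wall, refl, mul_assoc, hl₂, hl₃, hl₄, hl₅] at * <;> omega
  · rintro a (rfl | rfl | rfl | rfl | rfl | rfl) a' (rfl | rfl | rfl | rfl | rfl | rfl) g hg hg' <;>
      simp [doubleChamber, center, refl, mul_assoc] at hg hg' ⊢ <;> omega
  · intro g _
    have h₀ := length_simple_mul cs g 1
    have h₁ := isCenter cs g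
    simp [doubleChamber, IsCenter, center, refl, mul_assoc] at *
    omega

/-- Here `w₂` acts by `(x, y) ↦ (6 - x, x + y)`; the new `x + y` is `y + 6`, so the image is the
part with `x + y > 6`. -/
theorem isReducedProduct_doubleChamber :
    cs.IsReducedProduct
      (nonnegPowers (cs.simple 2 * cs.simple 0 * cs.simple 1 * cs.simple 0 * cs.simple 1))
      (strip cs) (doubleChamber cs) := by
  have hl : cs.length
      (cs.simple 2 * cs.simple 0 * cs.simple 1 * cs.simple 0 * cs.simple 1) = 5 := by
    simp [length_eq, center, refl, depth, mul_assoc]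
  refine CoxeterSystem.IsReducedProduct.nonnegPowers ?_ ?_ ?_ ?_ ?_
  · intro h
    simp [h] at hl
  · simp [doubleChamber, center]
  · intro g hg
    have h₁ := length_simple_mul cs g 1
    have h₂ := length_simple_mul cs (cs.simple 1 * g) 0
    have h₃ := length_simple_mul cs (cs.simple 0 * (cs.simple 1 * g)) 1
    have h₄ := length_simple_mul cs (cs.simple 1 * (cs.simple 0 * (cs.simple 1 * g))) 0
    have h₅ := length_simple_mul cs
      (cs.simple 0 * (cs.simple 1 * (cs.simple 0 * (cs.simple 1 * g)))) 2
    simp [doubleChamber, center, wall, refl, mul_assoc] at *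
    omega
  · intro g hg
    simp [doubleChamber, strip, center, refl, mul_assoc] at *
    omega
  · intro g hg
    obtain ⟨-, -, h₃, -⟩ := isCenter cs g
    simp [doubleChamber, strip, center, refl, mul_assoc] at *
    omega

/-- This triangle is the union of the six alcoves around the vertex `(0, 2)` fixed by `s₁` and `s₃`.
-/
theorem eq_of_mem_triangle {q : ℤ × ℤ} (h : IsCenter q) (h₁ : 0 < q.2) (h₂ : 0 < q.1 + q.2)
    (h₃ : q.1 + 2 * q.2 < 6) : q = (1, 1) ∨ q = (-1, 2) ∨ q = (2, 1) ∨ q = (-2, 3) ∨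
      q = (1, 2) ∨ q = (-1, 3) := by
  obtain ⟨x, y⟩ := q
  simp only [IsCenter, Prod.mk.injEq] at *
  have hy : y ≤ 4 := by omega
  interval_cases y <;> omega

theorem isReducedProduct_strip :
    cs.IsReducedProduct (nonnegPowers (cs.simple 2 * cs.simple 0 * cs.simple 1))
      (cs.parabolic {0, 2} : Set W) (strip cs) := by
  have hl : cs.length (cs.simple 2 * cs.simple 0 * cs.simple 1) = 3 := by
    simp [length_eq, center, refl, depth, mul_assoc]
  refine CoxeterSystem.IsReducedProduct.nonnegPowers ?_ ?_ ?_ ?_ ?_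
  · intro h
    simp [h] at hl
  · simp [strip, center]
  · intro g hg
    have h₁ := length_simple_mul cs g 1
    have h₂ := length_simple_mul cs (cs.simple 1 * g) 0
    have h₃ := length_simple_mul cs (cs.simple 0 * (cs.simple 1 * g)) 2
    simp [strip, center, wall, refl, mul_assoc] at *
    omega
  · intro g hg
    rw [SetLike.mem_coe, mem_parabolic_zero_two_iff] at hg
    simp [strip, center, refl, mul_assoc, Prod.ext_iff] at *
    omega
  · intro g hg
    have h₀ := isCenter cs g
    rw [SetLike.mem_coe, mem_parabolic_zero_two_iff]
    -- Here `w₁` acts by `(x, y) ↦ (6 - 2x - 3y, x + 2y)`, so the new `x + 2y` is `y + 6`: the line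
    -- `x + 2y = 6` separates the triangle from the image of the half-strip.
    by_cases hxy : (center cs g).1 + 2 * (center cs g).2 < 6
    · exact Or.inl (eq_of_mem_triangle h₀ hg.1 hg.2.1 hxy)
    · right
      obtain ⟨-, -, -, h₄, -⟩ := h₀
      simp [strip, center, refl, mul_assoc] at *
      omega

theorem poincareSeries_and_isFactorization :
    (∏ i, cs.poincareSeries (factorsG2 cs i)) = cs.poincareSeries Set.univ ∧
      IsFactorization (factorsG2 cs) := by
  rw [factorsG2, minLeftCosetReps_one_zero]
  have h₁ := isReducedProduct_univ cs
  have h₂ := isReducedProduct_doubleChamber cs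
  have h₃ := isReducedProduct_strip cs
  constructor
  · rw [← h₁.poincareSeries_eq, ← h₂.poincareSeries_eq, ← h₃.poincareSeries_eq]
    simp [Fin.prod_univ_succ]
  · have := h₁.factorizesSet (h₂.factorizesSet (h₃.factorizesSet
      (CoxeterSystem.factorizesSet_singleton _)))
    exact fun w => this.2 w trivial

end AffineG2

theorem mainTheorem8 {W : Type*} [Group W] :
    (∀ cs : CoxeterSystem affineA2 W,
      (∏ i, cs.poincareSeries (factorsA2 cs i)) = cs.poincareSeries Set.univ ∧
        IsFactorization (factorsA2 cs)) ∧
    (∀ cs : CoxeterSystem affineC2 W,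
      (∏ i, cs.poincareSeries (factorsC2 cs i)) = cs.poincareSeries Set.univ ∧
        IsFactorization (factorsC2 cs)) ∧
    (∀ cs : CoxeterSystem affineG2 W,
      (∏ i, cs.poincareSeries (factorsG2 cs i)) = cs.poincareSeries Set.univ ∧
        IsFactorization (factorsG2 cs)) :=
  ⟨AffineA2.poincareSeries_and_isFactorization, AffineC2.poincareSeries_and_isFactorization,
    AffineG2.poincareSeries_and_isFactorization⟩
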